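/- **Setting.** Let $P$ be a probability measure on $\mathbb{R}^d$ supported on a compact set, let $\boldsymbol x\sim P$, and let $\boldsymbol n$ be a real noise variable, independent of $\boldsymbol x$, with $\mathbb{E}[\boldsymbol n]=0$ and $\mathbb{E}[\boldsymbol n^2]<\infty$. Let $\{\phi_j\}_{j\ge1}$ be an orthonormal basis of $L_2(P)$, let $\lambda_1\ge\lambda_2\ge\cdots>0$ with $\lambda_j\to0$, and let $$\mathcal F=\Big\{f=\sum_{j\ge1}f_j\phi_j\in L_2(P):\ \sum_{j\ge1}f_j^2/\lambda_j\le1\Big\}.$$ Given $f\in\mathcal F$ the response is $\boldsymbol y=f(\boldsymbol x)+\boldsymbol n$. Fix an integer $r\ge0$. A representation is a tuple $R=(\psi_1,\dots,\psi_r)\in\mathcal R:=L_2(P)^r$, and its regret is $$\mathrm{reg}(R,f)=\inf_{q\in\mathbb{R}^r}\mathbb{E}\Big[\Big(\boldsymbol y-\sum_{i=1}^r q_i\psi_i(\boldsymbol x)\Big)^2\Big]-\inf_{g\in L_2(P)}\mathbb{E}\big[(\boldsymbol y-g(\boldsymbol x))^2\big].$$ The mixed minimax regret is $\inf_{\mu}\sup_{f\in\mathcal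 F}\mathbb{E}_{\boldsymbol R\sim\mu}[\mathrm{reg}(\boldsymbol R,f)]$, over all Borel probability laws $\mu$ on $\mathcal R$; a law attaining the infimum is called minimax. The mixed maximin regret is $\sup_\nu\inf_{R\in\mathcal R}\mathbb{E}_{\boldsymbol f\sim\nu}[\mathrm{reg}(R,\boldsymbol f)]$, over all Borel probability laws $\nu$ on $L_2(P)$ supported on $\mathcal F$; a law attaining the supremum is called a least favorable prior. **Theorem.** The regret is Borel measurable in $R$ and in $f$, and $0\le\mathrm{reg}(R,f)\le\lambda_1$ for $f\in\mathcal F$, so all the expectations above are well defined. There is an integer $\ell>r$ with $$(\ell-r)\,\lambda_\ell^{-1}\ \le\ \sum_{i=1}^{\ell}\lambda_i^{-1}\ \le\ (\ell-r)\,\lambda_{\ell+1}^{-1},$$ and for every such integer $\ell^*$ the following hold. 1. The mixed minimax regret and the mixed maximin regret both equal $$\frac{\ell^*-r}{\sum_{i=1}^{\ell^*}\lambda_i^{-1}}.$$ 2. If $\boldsymbol b_1,\boldsymbol b_2,\dots$ are i.i.d. Rademacher variables ($\mathbb{P}[\boldsymbol b_i=\pm1]=1/2$), then the law of $$\boldsymbol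 f^*=\sum_{i=1}^{\ell^*}\frac{\boldsymbol b_i}{\sqrt{\sum_{j=1}^{\ell^*}\lambda_j^{-1}}}\,\phi_i$$ is a least favorable prior. 3. Let $\overline A$ be the $0$-$1$ matrix with rows indexed by $i\in\{1,\dots,\ell^*\}$ and columns indexed by the $r$-element subsets $I$ of $\{1,\dots,\ell^*\}$, with $\overline A_{iI}=0$ if $i\in I$ and $\overline A_{iI}=1$ otherwise, and let $\overline b_i=(\ell^*-r)\,\lambda_i^{-1}/\sum_{j=1}^{\ell^*}\lambda_j^{-1}$. Then $\overline A p=\overline b$ has a solution $p$ with entries in $[0,1]$ and at most $\ell^*+1$ nonzero entries. For every solution $p$ with entries in $[0,1]$, the law of the random representation which equals $(\phi_i)_{i\in I}$ with probability $p_I$ is minimax. -/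

import Mathlib

open MeasureTheory ProbabilityTheory Filter Topology

noncomputable section

namespace HilbertMSE

/-- The feature space `ℝ^d`. -/
abbrev Feature (d : ℕ) : Type := EuclideanSpace ℝ (Fin d)

/-- The Hilbert space `L₂(P)` of square integrable functions of the features. -/
abbrev L2 {d : ℕ} (P : Measure (Feature d)) : Type := Lp ℝ 2 P

/-- `L₂(P)` carries its Borel σ-algebra. -/
instance instMeasurableSpaceL2 {d : ℕ} (P : Measure (Feature d)) :
    MeasurableSpace (Lp ℝ 2 P) := borel _

instance instBorelSpaceL2 {d : ℕ} (P : Measure (Feature d)) :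
    BorelSpace (Lp ℝ 2 P) := ⟨rfl⟩

/-- A representation is an `r`-tuple `(ψ₁, …, ψ_r)` of functions in `L₂(P)`.
It carries the product σ-algebra. -/
abbrev Rep {d : ℕ} (P : Measure (Feature d)) (r : ℕ) : Type := Fin r → Lp ℝ 2 P

section Game

variable {d : ℕ} {P : Measure (Feature d)} {Ω : Type*} [MeasurableSpace Ω]

/-- The mean squared error `E[(y - Q(x))²]` of a predictor `Q`, a function of the features, for the
response `y = f(x) + n`. -/
def loss (Pr : Measure Ω) (x : Ω → Feature d) (n : Ω → ℝ)
    (f : L2 P) (Q : Feature d → ℝ) : ℝ :=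
  ∫ ω, ((f (x ω) + n ω) - Q (x ω)) ^ 2 ∂Pr

/-- The pointwise regret of the representation `R` for the response function `f`: the least loss of
a linear predictor `q ↦ ∑ i, q i * ψ i (x)` of the representation, minus the least loss of a
predictor in `L₂(P)` which sees the features themselves. -/
def regret {r : ℕ} (Pr : Measure Ω) (x : Ω → Feature d) (n : Ω → ℝ)
    (R : Rep P r) (f : L2 P) : ℝ :=
  (⨅ q : Fin r → ℝ, loss Pr x n f (fun t => ∑ i, q i * R i t)) -
    ⨅ g : L2 P, loss Pr x n f (fun t => g t)

/-- The ellipsoid of all `f = ∑ f_j φ_j` in `L₂(P)` with `∑ f_j² / λ_j ≤ 1`. -/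
def ellipsoid (φ : HilbertBasis ℕ ℝ (L2 P)) (lam : ℕ → ℝ) : Set (L2 P) :=
  {f | Summable (fun j => (φ.repr f j) ^ 2 / lam j) ∧ ∑' j, (φ.repr f j) ^ 2 / lam j ≤ 1}

/-- The worst expected regret, over response functions in `F`, of a random representation with
law `μ`. -/
def worstRegret {r : ℕ} (Pr : Measure Ω) (x : Ω → Feature d) (n : Ω → ℝ)
    (F : Set (L2 P)) (μ : Measure (Rep P r)) : ℝ :=
  ⨆ f : F, ∫ R, regret Pr x n R (f : L2 P) ∂μ

/-- The minimax regret in mixed strategies. -/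
def mixedMinimaxRegret (r : ℕ) (Pr : Measure Ω) (x : Ω → Feature d) (n : Ω → ℝ)
    (F : Set (L2 P)) : ℝ :=
  ⨅ μ : {μ : Measure (Rep P r) // IsProbabilityMeasure μ}, worstRegret Pr x n F μ.1

/-- `μ` is the law of a minimax representation in mixed strategies. -/
def IsMinimaxLaw {r : ℕ} (Pr : Measure Ω) (x : Ω → Feature d) (n : Ω → ℝ)
    (F : Set (L2 P)) (μ : Measure (Rep P r)) : Prop :=
  IsProbabilityMeasure μ ∧ worstRegret Pr x n F μ = mixedMinimaxRegret r Pr x n F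

/-- `ν` is a prior on `F`: a probability law on `L₂(P)` which is supported on `F`. -/
def IsPrior (F : Set (L2 P)) (ν : Measure (L2 P)) : Prop :=
  IsProbabilityMeasure ν ∧ ∀ᵐ f ∂ν, f ∈ F

/-- The least expected regret of a (deterministic) representation under the prior `ν`. -/
def bayesRegret (r : ℕ) (Pr : Measure Ω) (x : Ω → Feature d) (n : Ω → ℝ)
    (ν : Measure (L2 P)) : ℝ :=
  ⨅ R : Rep P r, ∫ f, regret Pr x n R f ∂ν

/-- The maximin regret in mixed strategies. -/
def mixedMaximinRegret (r : ℕ) (Pr : Measure Ω) (x : Ω → Feature d) (n : Ω → ℝ)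
    (F : Set (L2 P)) : ℝ :=
  ⨆ ν : {ν : Measure (L2 P) // IsPrior F ν}, bayesRegret r Pr x n ν.1

/-- `ν` is a least favorable prior: it attains the maximin regret. -/
def IsLeastFavorable (r : ℕ) (Pr : Measure Ω) (x : Ω → Feature d) (n : Ω → ℝ)
    (F : Set (L2 P)) (ν : Measure (L2 P)) : Prop :=
  IsPrior F ν ∧ bayesRegret r Pr x n ν = mixedMaximinRegret r Pr x n F

end Game

/-- `∑_{i ≤ ℓ} 1 / λ_i`; the entry `lam i` is `λ_{i+1}`. -/
def invSum (lam : ℕ → ℝ) (l : ℕ) : ℝ := ∑ i ∈ Finset.range l, (lam i)⁻¹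

/-- The condition `(ℓ - r) / λ_ℓ ≤ ∑_{i ≤ ℓ} 1 / λ_i ≤ (ℓ - r) / λ_{ℓ+1}` on the
effective dimension `ℓ > r`; the entry `lam i` is `λ_{i+1}`. -/
def IsEffectiveDim (lam : ℕ → ℝ) (r l : ℕ) : Prop :=
  r < l ∧ ((l : ℝ) - r) * (lam (l - 1))⁻¹ ≤ invSum lam l ∧
    invSum lam l ≤ ((l : ℝ) - r) * (lam l)⁻¹

/-- The law of a fair random sign. -/
def rademacher : Measure ℝ :=
  (2⁻¹ : ENNReal) • Measure.dirac (1 : ℝ) + (2⁻¹ : ENNReal) • Measure.dirac (-1 : ℝ)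

/-- The `r`-element subsets of the first `ℓ` indices. -/
abbrev RSubset (l r : ℕ) : Type := {I : Finset (Fin l) // I.card = r}

/-- The 0-1 matrix whose columns are the vectors in `{0,1}^ℓ` with exactly `r` zeros; the column
of `I` has its zeros at the indices in `I`. -/
def zeroOneMatrix (l r : ℕ) : Matrix (Fin l) (RSubset l r) ℝ :=
  Matrix.of fun i I => if i ∈ I.1 then 0 else 1

/-- The vector with entries `(ℓ - r) λ_i⁻¹ / ∑_{j ≤ ℓ} λ_j⁻¹`. -/
def targetVec (lam : ℕ → ℝ) (r l : ℕ) : Fin l → ℝ :=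
  fun i => ((l : ℝ) - r) * ((lam i)⁻¹ / invSum lam l)

/-- The representation by the `r` basis functions with indices in `I`. -/
def subsetRep {d : ℕ} {P : Measure (Feature d)} (φ : HilbertBasis ℕ ℝ (L2 P)) {l r : ℕ}
    (I : RSubset l r) : Rep P r :=
  fun k => φ (I.1.orderEmbOfFin I.2 k : Fin l)

/-- The law of the random representation which is `subsetRep φ I` with probability `p I`. -/
def subsetLaw {d : ℕ} {P : Measure (Feature d)} (φ : HilbertBasis ℕ ℝ (L2 P)) {l r : ℕ}
    (p : RSubset l r → ℝ) : Measure (Rep P r) :=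
  ∑ I, ENNReal.ofReal (p I) • Measure.dirac (subsetRep φ I)

/-- The random function `∑_{i ≤ ℓ} b_i (∑_{j ≤ ℓ} 1 / λ_j)^{-1/2} φ_i`. -/
def signFunction {d : ℕ} {P : Measure (Feature d)} {Ω' : Type*}
    (φ : HilbertBasis ℕ ℝ (L2 P)) (lam : ℕ → ℝ) (l : ℕ) (b : ℕ → Ω' → ℝ) (ω : Ω') : L2 P :=
  ∑ i ∈ Finset.range l, (b i ω * (1 / Real.sqrt (invSum lam l))) • φ i

end HilbertMSE

end

/-! For square integrable predictors the loss is the squared `L₂`-distance plus the noise variance,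
so the regret is the squared distance of `f` to the span of `R` (`regret_eq`). Put `S = invSum lam
l` and `V = (l - r) / S`; a saddle point of value `V` is exhibited.

Upper bound: draw an `r`-subset of the first `l` basis functions so that `i` is left out with
probability `V / λ_i`. The left half of `IsEffectiveDim` makes these numbers at most `1`. They sum
to `l - r`, so they form a point of a hypersimplex, whose vertices are the columns of the matrix
(`exists_zeroOneMatrix_mulVec_eq`). On the ellipsoid the expected error is at most `∑_{i ≤ l} (V /
λ_i) f_i² + ∑_{i > l} f_i²`, which is at most `V ∑ f_i² / λ_i ≤ V`, because the right half says
`λ_{l+1} ≤ V` (`sum_mul_sqDistSpan_subsetRep_le`).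

Lower bound: the random sign function lies on the boundary of the ellipsoid and has squared norm `l
/ S`. Its `l` coordinates are uncorrelated with second moment `1 / S`, so by Bessel `r` directions
capture at most `r / S` on average (`le_integral_sqDistSpan_signFunction`). Weak duality, which is
Fubini's theorem, closes the gap. -/

noncomputable section

namespace HilbertMSE

/-! ### Squared distance to the span of a tuple -/

section SqDistSpan

open scoped RealInnerProductSpace

variable {E : Type*} [NormedAddCommGroup E] [InnerProductSpace ℝ E] {r : ℕ}

/-- The squared distance of `f` to the span of the tuple `R`. -/
def sqDistSpan (R : Fin r → E) (f : E) : ℝ := ⨅ q : Fin r → ℝ, ‖f - ∑ i, q i • R i‖ ^ 2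

theorem bddBelow_sqDistSpan (R : Fin r → E) (f : E) :
    BddBelow (Set.range fun q : Fin r → ℝ => ‖f - ∑ i, q i • R i‖ ^ 2) :=
  ⟨0, by rintro _ ⟨q, rfl⟩; positivity⟩

theorem sqDistSpan_nonneg (R : Fin r → E) (f : E) : 0 ≤ sqDistSpan R f :=
  le_ciInf fun _ => by positivity

theorem sqDistSpan_le (R : Fin r → E) (f : E) (q : Fin r → ℝ) :
    sqDistSpan R f ≤ ‖f - ∑ i, q i • R i‖ ^ 2 :=
  ciInf_le (bddBelow_sqDistSpan R f) q

theorem sqDistSpan_le_norm_sq (R : Fin r → E) (f : E) : sqDistSpan R f ≤ ‖f‖ ^ 2 := by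
  simpa using sqDistSpan_le R f 0

/-- An infimum over uncountably many `q` need not preserve measurability, but an infimum of
continuous functions is upper semicontinuous. Joint measurability is what Fubini's theorem needs
later. -/
theorem measurable_sqDistSpan [MeasurableSpace E] [BorelSpace E] [SecondCountableTopology E] :
    Measurable fun p : (Fin r → E) × E => sqDistSpan p.1 p.2 := by
  refine UpperSemicontinuous.measurable (upperSemicontinuous_ciInf
    (fun p => bddBelow_sqDistSpan p.1 p.2) fun q => Continuous.upperSemicontinuous ?_)
  fun_prop

theorem measurable_sqDistSpan_left [MeasurableSpace E] [BorelSpace E]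
    [SecondCountableTopology E] (f : E) : Measurable fun R : Fin r → E => sqDistSpan R f := by
  refine UpperSemicontinuous.measurable (upperSemicontinuous_ciInf
    (fun R => bddBelow_sqDistSpan R f) fun q => Continuous.upperSemicontinuous ?_)
  fun_prop

theorem measurable_sqDistSpan_right [MeasurableSpace E] [BorelSpace E]
    [SecondCountableTopology E] (R : Fin r → E) : Measurable fun f : E => sqDistSpan R f := by
  refine UpperSemicontinuous.measurable (upperSemicontinuous_ciInf
    (fun f => bddBelow_sqDistSpan R f) fun q => Continuous.upperSemicontinuous ?_)
  fun_prop

theorem sqDistSpan_le_of_orthonormal {v : Fin r → E} (hv : Orthonormal ℝ v) (f : E) :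
    sqDistSpan v f ≤ ‖f‖ ^ 2 - ∑ k, ⟪v k, f⟫ ^ 2 := by
  refine (sqDistSpan_le v f fun k => ⟪v k, f⟫).trans_eq ?_
  rw [norm_sub_sq_real, inner_sum, ← real_inner_self_eq_norm_sq (∑ i, _), hv.inner_sum]
  simp only [inner_smul_right, real_inner_comm f, conj_trivial, ← pow_two]
  ring

/-- Take an orthonormal basis of the span. Its length `m` may be smaller than `r`, since `R` may be
linearly dependent. -/
theorem exists_orthonormal_le_sqDistSpan (R : Fin r → E) :
    ∃ (m : ℕ) (e : Fin m → E), m ≤ r ∧ Orthonormal ℝ e ∧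
      ∀ f, ‖f‖ ^ 2 - ∑ k, ⟪e k, f⟫ ^ 2 ≤ sqDistSpan R f := by
  set U := Submodule.span ℝ (Set.range R)
  have : FiniteDimensional ℝ U := FiniteDimensional.span_of_finite ℝ (Set.finite_range R)
  set b := stdOrthonormalBasis ℝ U
  have he : Orthonormal ℝ fun k => (b k : E) :=
    b.orthonormal.comp_linearIsometry U.subtypeₗᵢ
  refine ⟨_, fun k => (b k : E), (finrank_range_le_card R).trans_eq (Fintype.card_fin r), he, fun f => ?_⟩
  refine le_ciInf fun q => ?_
  have hmem : ∑ i, q i • R i ∈ U := Submodule.sum_mem _ fun i _ =>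
    Submodule.smul_mem _ _ (Submodule.subset_span (Set.mem_range_self i))
  obtain ⟨c, hc⟩ : ∃ c : Fin _ → ℝ, ∑ i, q i • R i = ∑ k, c k • (b k : E) := by
    refine ⟨fun k => b.repr ⟨_, hmem⟩ k, ?_⟩
    simpa using (congrArg Subtype.val (b.sum_repr ⟨_, hmem⟩)).symm
  rw [hc, norm_sub_sq_real, inner_sum, ← real_inner_self_eq_norm_sq (∑ i, _), he.inner_sum]
  simp only [inner_smul_right, real_inner_comm f, conj_trivial]
  -- Completing the square: this sum is exactly the excess of the squared error over its value at
  -- the Fourier coefficients.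
  have h : 0 ≤ ∑ k, (c k - ⟪(b k : E), f⟫) ^ 2 := Finset.sum_nonneg fun _ _ => sq_nonneg _
  simp only [sub_sq, Finset.sum_add_distrib, Finset.sum_sub_distrib, mul_assoc,
    ← Finset.mul_sum, pow_two (c _), real_inner_comm f] at h ⊢
  linarith

end SqDistSpan

/-! ### Reduction of the regret to a distance -/

section Regret

variable {d : ℕ} {P : Measure (Feature d)} {Ω : Type*} [MeasurableSpace Ω]
  {Pr : Measure Ω} {x : Ω → Feature d} {n : Ω → ℝ}

/-- For square integrable predictors the loss is the squared `L₂`-distance plus the noise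
variance. -/
theorem loss_eq [IsProbabilityMeasure Pr] (hx : HasLaw x P Pr) (hn : MemLp n 2 Pr)
    (hn0 : ∫ ω, n ω ∂Pr = 0) (hxn : IndepFun x n Pr) (f g : L2 P) {Q : Feature d → ℝ}
    (hQ : Q =ᵐ[P] g) :
    loss Pr x n f Q = ‖f - g‖ ^ 2 + ∫ ω, n ω ^ 2 ∂Pr := by
  set h : L2 P := f - g with hh
  have hhm : Measurable (h : Feature d → ℝ) := (Lp.stronglyMeasurable h).measurable
  have hdiff : ∀ᵐ ω ∂Pr, f (x ω) - Q (x ω) = h (x ω) := by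
    have h1 : ∀ᵐ t ∂P, f t - Q t = h t := by
      filter_upwards [hQ, Lp.coeFn_sub f g] with t h1 h2
      rw [h1, hh, h2, Pi.sub_apply]
    have h2 : Tendsto x (ae Pr) (ae P) := by
      simpa only [hx.map_eq] using Measure.tendsto_ae_map hx.aemeasurable
    exact h2.eventually h1
  have hhL : MemLp (fun ω => h (x ω)) 2 Pr := by
    have h1 : MemLp h 2 (Pr.map x) := by rw [hx.map_eq]; exact Lp.memLp h
    exact (memLp_map_measure_iff h1.1 hx.aemeasurable).1 h1
  -- The cross term factors by independence, and the noise has mean zero.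
  have hcross : ∫ ω, h (x ω) * n ω ∂Pr = 0 := by
    have hi : IndepFun (fun ω => h (x ω)) n Pr := hxn.comp hhm measurable_id
    rw [hi.integral_fun_mul_eq_mul_integral hhL.1 hn.1, hn0, mul_zero]
  have hsq : ∫ ω, h (x ω) ^ 2 ∂Pr = ‖h‖ ^ 2 := by
    have h1 : ∫ ω, h (x ω) ^ 2 ∂Pr = ∫ t, h t ^ 2 ∂P := by
      exact hx.integral_comp (f := fun t => h t ^ 2) (hhm.pow_const 2).aestronglyMeasurable
    rw [h1, ← real_inner_self_eq_norm_sq, L2.inner_def]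
    refine integral_congr_ae (Eventually.of_forall fun t => ?_)
    simp [pow_two]
  have hint : Integrable (fun ω => h (x ω) * n ω) Pr := hhL.integrable_mul hn
  calc loss Pr x n f Q
      = ∫ ω, (h (x ω) ^ 2 + 2 * (h (x ω) * n ω)) + n ω ^ 2 ∂Pr := by
        refine integral_congr_ae ?_
        filter_upwards [hdiff] with ω hω
        rw [← hω]; ring
    _ = ‖h‖ ^ 2 + ∫ ω, n ω ^ 2 ∂Pr := by
        rw [integral_add (f := fun ω => h (x ω) ^ 2 + 2 * (h (x ω) * n ω)) (hhL.integrable_sq.add (hint.const_mul 2)) hn.integrable_sq,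
          integral_add hhL.integrable_sq (hint.const_mul 2), integral_const_mul, hcross, hsq]
        simp

theorem coeFn_sum_smul {r : ℕ} (R : Rep P r) (q : Fin r → ℝ) :
    (fun t => ∑ i, q i * R i t) =ᵐ[P] (∑ i, q i • R i : L2 P) := by
  have h1 := Lp.coeFn_fun_finsetSum Finset.univ fun i => q i • R i
  have h2 : ∀ᵐ t ∂P, ∀ i, (q i • R i : L2 P) t = q i * R i t := by
    rw [ae_all_iff]
    intro i
    filter_upwards [Lp.coeFn_smul (q i) (R i)] with t ht
    simpa using ht
  filter_upwards [h1, h2] with t h1 h2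
  rw [h1]
  exact Finset.sum_congr rfl fun i _ => (h2 i).symm

/-- The regret is the squared distance to the span of the representation. -/
theorem regret_eq [IsProbabilityMeasure Pr] (hx : HasLaw x P Pr) (hn : MemLp n 2 Pr)
    (hn0 : ∫ ω, n ω ∂Pr = 0) (hxn : IndepFun x n Pr) {r : ℕ} (R : Rep P r) (f : L2 P) :
    regret Pr x n R f = sqDistSpan R f := by
  have hb := bddBelow_sqDistSpan R f
  have h1 : ∀ q : Fin r → ℝ, loss Pr x n f (fun t => ∑ i, q i * R i t) =
      ‖f - ∑ i, q i • R i‖ ^ 2 + ∫ ω, n ω ^ 2 ∂Pr := fun q =>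
    loss_eq hx hn hn0 hxn f _ (coeFn_sum_smul R q)
  have h2 : ∀ g : L2 P, loss Pr x n f (fun t => g t) = ‖f - g‖ ^ 2 + ∫ ω, n ω ^ 2 ∂Pr :=
    fun g => loss_eq hx hn hn0 hxn f g (EventuallyEq.refl _ _)
  -- The infimum is attained at `g = f`, so only the noise variance remains; it cancels in the
  -- regret.
  have h3 : ⨅ g : L2 P, (‖f - g‖ ^ 2 + ∫ ω, n ω ^ 2 ∂Pr) = ∫ ω, n ω ^ 2 ∂Pr := by
    refine le_antisymm ?_ (le_ciInf fun g => by simp)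
    refine (ciInf_le ⟨∫ ω, n ω ^ 2 ∂Pr, ?_⟩ f).trans (by simp)
    rintro _ ⟨g, rfl⟩
    simp
  simp only [regret, sqDistSpan, h1, h2, h3]
  rw [← ciInf_add hb]
  ring

end Regret

/-! ### Vertices of the hypersimplex -/

section Hypersimplex

/-- The points of the unit cube whose coordinates sum to `k`. -/
def hypersimplex (l : ℕ) (k : ℝ) : Set (Fin l → ℝ) :=
  {a | (∀ i, a i ∈ Set.Icc (0 : ℝ) 1) ∧ ∑ i, a i = k}

theorem convex_hypersimplex (l : ℕ) (k : ℝ) : Convex ℝ (hypersimplex l k) := by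
  rintro a ⟨ha, hak⟩ b ⟨hb, hbk⟩ s t hs ht hst
  refine ⟨fun i => convex_Icc (0 : ℝ) 1 (ha i) (hb i) hs ht hst, ?_⟩
  simp only [Pi.add_apply, Pi.smul_apply, smul_eq_mul, Finset.sum_add_distrib,
    ← Finset.mul_sum, hak, hbk, ← add_mul, hst, one_mul]

theorem isCompact_hypersimplex (l : ℕ) (k : ℝ) : IsCompact (hypersimplex l k) := by
  have h : hypersimplex l k =
      (Set.univ.pi fun _ => Set.Icc (0 : ℝ) 1) ∩ {a | ∑ i, a i = k} := by
    ext a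
    simp only [hypersimplex, Set.mem_inter_iff, Set.mem_univ_pi]
    rfl
  rw [h]
  refine (isCompact_univ_pi fun _ => isCompact_Icc).inter_right ?_
  exact isClosed_eq (by fun_prop) continuous_const

/-- The extreme points of the hypersimplex are `0`-`1` vectors. -/
theorem zero_or_one_of_mem_extremePoints {l k : ℕ} {a : Fin l → ℝ}
    (ha : a ∈ (hypersimplex l (k : ℝ)).extremePoints ℝ) (i : Fin l) : a i = 0 ∨ a i = 1 := by
  obtain ⟨⟨hcube, hsum⟩, hext⟩ := ha
  by_contra hi
  push Not at hi
  have hi0 : 0 < a i := lt_of_le_of_ne (hcube i).1 hi.1.symm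
  have hi1 : a i < 1 := lt_of_le_of_ne (hcube i).2 hi.2
  -- One fractional coordinate forces another: if the rest were `0` or `1`, then `a i` would be an
  -- integer strictly between `0` and `1`.
  obtain ⟨j, hji, hj⟩ : ∃ j, j ≠ i ∧ (a j ≠ 0 ∧ a j ≠ 1) := by
    by_contra hall
    push Not at hall
    have hint : ∃ z : ℤ, ∑ j ∈ Finset.univ.erase i, a j = z := by
      refine ⟨∑ j ∈ Finset.univ.erase i, if a j = 0 then 0 else 1, ?_⟩
      push_cast
      refine Finset.sum_congr rfl fun j hj => ?_
      by_cases h0 : a j = 0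
      · simp [h0]
      · simp [hall j (Finset.ne_of_mem_erase hj) h0]
    obtain ⟨z, hz⟩ := hint
    have h := Finset.add_sum_erase Finset.univ a (Finset.mem_univ i)
    rw [hsum, hz] at h
    have h1 : ((k - z : ℤ) : ℝ) = a i := by push_cast; linarith
    have h2 : (0 : ℤ) < k - z := by exact_mod_cast h1 ▸ hi0
    have h3 : (k - z : ℤ) < 1 := by exact_mod_cast h1 ▸ hi1
    omega
  have hj0 : 0 < a j := lt_of_le_of_ne (hcube j).1 hj.1.symm
  have hj1 : a j < 1 := lt_of_le_of_ne (hcube j).2 hj.2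
  -- Moving `e` from one fractional coordinate to the other, in either direction, keeps the sum and
  -- stays in the cube, so `a` is a midpoint.
  obtain ⟨e, he0, he⟩ : ∃ e : ℝ, 0 < e ∧ e ≤ a i ∧ e ≤ 1 - a i ∧ e ≤ a j ∧ e ≤ 1 - a j :=
    ⟨min (min (a i) (1 - a i)) (min (a j) (1 - a j)), by simp [hi0, hi1, hj0, hj1],
      by simp, by simp, by simp, by simp⟩
  have hmem : ∀ s : ℝ, |s| ≤ 1 →
      a + (s * e) • (Pi.single i 1 - Pi.single j 1) ∈ hypersimplex l (k : ℝ) := by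
    intro s hs
    have hs' := abs_le.1 hs
    have h1 : s * e ≤ e := by nlinarith
    have h2 : -e ≤ s * e := by nlinarith
    refine ⟨fun t => ?_, ?_⟩
    · by_cases hti : t = i
      · subst hti
        simp [hji.symm]
        constructor <;> linarith
      · by_cases htj : t = j
        · subst htj
          simp [hti]
          constructor <;> linarith
        · simpa [Pi.single_apply, hti, htj] using hcube t
    · simp [Finset.sum_add_distrib, hsum, ← Finset.mul_sum]
  have hseg : a ∈ openSegment ℝ (a + ((1 : ℝ) * e) • (Pi.single i 1 - Pi.single j 1))
      (a + ((-1 : ℝ) * e) • (Pi.single i 1 - Pi.single j 1)) := by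
    refine ⟨1 / 2, 1 / 2, by norm_num, by norm_num, by norm_num, ?_⟩
    module
  have h := congrFun (hext (hmem 1 (by simp)) (hmem (-1) (by simp)) hseg) i
  simp [hji.symm] at h
  linarith

/-- Every point of the cube with coordinate sum `l - r` is a convex combination of at most `l + 1`
columns of the `0`-`1` matrix. -/
theorem exists_zeroOneMatrix_mulVec_eq {l r : ℕ} (hr : r ≤ l) {a : Fin l → ℝ}
    (ha : ∀ i, a i ∈ Set.Icc (0 : ℝ) 1) (hsum : ∑ i, a i = (l : ℝ) - r) :
    ∃ p : RSubset l r → ℝ, (∀ I, p I ∈ Set.Icc (0 : ℝ) 1) ∧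
      (zeroOneMatrix l r).mulVec p = a ∧ {I | p I ≠ 0}.ncard ≤ l + 1 := by
  classical
  set c : RSubset l r → Fin l → ℝ := fun I i => if i ∈ I.1 then 0 else 1 with hc
  have hext : (hypersimplex l ((l - r : ℕ) : ℝ)).extremePoints ℝ ⊆ Set.range c := by
    intro v hv
    have h01 := zero_or_one_of_mem_extremePoints hv
    have hvs := hv.1.2
    have hcv : ∀ i, v i = if i ∈ Finset.univ.filter (fun i => v i = 0) then 0 else 1 := by
      intro i
      rcases h01 i with h | h <;> simp [h]
    have hcard : (Finset.univ.filter (fun i => v i = 0)).card = r := by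
      have h1 : ∑ i, (1 - v i) = ((Finset.univ.filter (fun i => v i = 0)).card : ℝ) := by
        rw [Finset.card_filter]
        push_cast
        refine Finset.sum_congr rfl fun i _ => ?_
        rcases h01 i with h | h <;> simp [h]
      rw [Finset.sum_sub_distrib, hvs] at h1
      push_cast [hr] at h1
      simp at h1
      exact_mod_cast h1.symm
    exact ⟨⟨_, hcard⟩, funext fun i => (hcv i).symm⟩
  -- Krein–Milman; the closure is superfluous because the hull of finitely many points is compact.
  have hmem : a ∈ convexHull ℝ (Set.range c) := by
    have h1 : a ∈ hypersimplex l ((l - r : ℕ) : ℝ) := ⟨ha, by push_cast [hr]; exact hsum⟩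
    rw [← closure_convexHull_extremePoints (isCompact_hypersimplex _ _)
      (convex_hypersimplex _ _)] at h1
    have h2 := closure_mono (convexHull_mono hext) h1
    rwa [((Set.finite_range c).isCompact_convexHull (𝕜 := ℝ)).isClosed.closure_eq] at h2
  -- Carathéodory: the points are affinely independent in dimension `l`, whence the bound `l + 1`.
  obtain ⟨ι, _, z, w, hz, hind, hw, hw1, hwz⟩ := eq_pos_convex_span_of_mem_convexHull hmem
  choose J hJ using fun i => hz (Set.mem_range_self i)
  have hle : ∀ s : Finset ι, ∑ i ∈ s, w i ≤ 1 := fun s => hw1 ▸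
    Finset.sum_le_sum_of_subset_of_nonneg (Finset.subset_univ s) fun i _ _ => (hw i).le
  refine ⟨fun I => ∑ i with J i = I, w i,
    fun I => ⟨Finset.sum_nonneg fun i _ => (hw i).le, hle _⟩, ?_, ?_⟩
  · ext t
    rw [← hwz, Finset.sum_apply]
    simp only [Matrix.mulVec, dotProduct, zeroOneMatrix, Matrix.of_apply, Finset.mul_sum]
    rw [← Finset.sum_fiberwise (s := Finset.univ) (g := J)]
    refine Finset.sum_congr rfl fun I _ => Finset.sum_congr rfl fun i hi => ?_
    rw [Pi.smul_apply, ← hJ i, (Finset.mem_filter.1 hi).2, smul_eq_mul, mul_comm]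
  · have hsub : {I | ∑ i with J i = I, w i ≠ 0} ⊆ Set.range J := by
      intro I hI
      obtain ⟨i, hi, -⟩ := Finset.exists_ne_zero_of_sum_ne_zero hI
      exact ⟨i, (Finset.mem_filter.1 hi).2⟩
    calc {I | ∑ i with J i = I, w i ≠ 0}.ncard
        ≤ (Set.range J).ncard := Set.ncard_le_ncard hsub (Set.toFinite _)
      _ ≤ Fintype.card ι := by
          rw [← Set.image_univ, ← Nat.card_eq_fintype_card, ← Set.ncard_univ]
          exact Set.ncard_image_le
      _ ≤ l + 1 := by
          refine hind.card_le_finrank_succ.trans ?_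
          have := Submodule.finrank_le (vectorSpan ℝ (Set.range z))
          simp at this
          omega

end Hypersimplex

/-! ### The effective dimension and its linear system -/

section EffectiveDim

variable {lam : ℕ → ℝ} {r l : ℕ}

theorem invSum_pos (hpos : ∀ j, 0 < lam j) (hl : 0 < l) : 0 < invSum lam l :=
  Finset.sum_pos (fun i _ => inv_pos.2 (hpos i)) ⟨0, by simpa using hl⟩

theorem exists_isEffectiveDim (hpos : ∀ j, 0 < lam j) (hanti : Antitone lam)
    (hlim : Tendsto lam atTop (𝓝 0)) (r : ℕ) : ∃ l, IsEffectiveDim lam r l := by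
  have hex : ∃ l, r < l ∧ invSum lam l ≤ ((l : ℝ) - r) * (lam l)⁻¹ := by
    by_contra hall
    push Not at hall
    -- Multiplying the failed inequality by `lam l` bounds a sum of nonnegative terms by `r`. Its
    -- first `r + 1` terms each tend to `1` as `l → ∞`, which is a contradiction.
    have hlt : ∀ l, r < l → ∑ i ∈ Finset.range (r + 1), (1 - lam l / lam i) < r := by
      intro l hl
      have h1 : ∑ i ∈ Finset.range l, (1 - lam l / lam i) < r := by
        have h2 := mul_lt_mul_of_pos_left (hall l hl) (hpos l)
        have h3 : lam l * invSum lam l = ∑ i ∈ Finset.range l, lam l / lam i := by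
          simp [invSum, Finset.mul_sum, div_eq_mul_inv]
        have h4 : lam l * (((l : ℝ) - r) * (lam l)⁻¹) = l - r := by
          field_simp [(hpos l).ne']
        rw [Finset.sum_sub_distrib, ← h3]
        simp
        linarith
      refine lt_of_le_of_lt (Finset.sum_le_sum_of_subset_of_nonneg ?_ fun i hi _ => ?_) h1
      · exact Finset.range_subset_range.2 hl
      · rw [sub_nonneg, div_le_one (hpos i)]
        exact hanti (Finset.mem_range.1 hi).le
    have ht : Tendsto (fun l => ∑ i ∈ Finset.range (r + 1), (1 - lam l / lam i)) atTop
        (𝓝 (∑ i ∈ Finset.range (r + 1), (1 - 0 / lam i))) :=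
      tendsto_finsetSum _ fun i _ => tendsto_const_nhds.sub (hlim.div_const _)
    have := le_of_tendsto ht ((eventually_gt_atTop r).mono fun l hl => (hlt l hl).le)
    simp at this
    linarith
  classical
  -- The least such `l` also satisfies the left inequality: failure at `m = l - 1`, with `(lam m)⁻¹`
  -- added to both sides, is that inequality. If `m = r`, it is trivial.
  obtain ⟨hr, h2⟩ := Nat.find_spec hex
  set l := Nat.find hex
  refine ⟨l, hr, ?_, h2⟩
  obtain ⟨m, hm⟩ : ∃ m, l = m + 1 := ⟨l - 1, by omega⟩
  have hS : invSum lam (m + 1) = invSum lam m + (lam m)⁻¹ := Finset.sum_range_succ _ _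
  have h0 : 0 < (lam m)⁻¹ := inv_pos.2 (hpos m)
  rw [hm, hS, Nat.add_sub_cancel]
  rcases eq_or_lt_of_le (Nat.lt_succ_iff.1 (hm ▸ hr)) with h | h
  · have : 0 ≤ invSum lam m := Finset.sum_nonneg fun i _ => (inv_pos.2 (hpos i)).le
    subst h
    push_cast
    linarith
  · have h3 := Nat.find_min hex (m := m) (by omega)
    push Not at h3
    have := h3 h
    push_cast
    linarith

theorem sum_targetVec (hpos : ∀ j, 0 < lam j) (hl : 0 < l) :
    ∑ i, targetVec lam r l i = (l : ℝ) - r := by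
  have h := (invSum_pos hpos hl).ne'
  simp only [targetVec]
  rw [← Finset.mul_sum, ← Finset.sum_div, Fin.sum_univ_eq_sum_range fun i => (lam i)⁻¹]
  change _ * (invSum lam l / invSum lam l) = _
  rw [div_self h, mul_one]

theorem IsEffectiveDim.targetVec_mem_Icc (h : IsEffectiveDim lam r l) (hpos : ∀ j, 0 < lam j)
    (hanti : Antitone lam) (i : Fin l) : targetVec lam r l i ∈ Set.Icc (0 : ℝ) 1 := by
  obtain ⟨hr, h1, -⟩ := h
  have hS := invSum_pos (l := l) hpos (by omega)
  have hlr : (0 : ℝ) < l - r := by simpa using hr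
  have hi := inv_pos.2 (hpos i)
  refine ⟨by unfold targetVec; positivity, ?_⟩
  rw [targetVec, ← mul_div_assoc, div_le_one hS]
  refine le_trans (mul_le_mul_of_nonneg_left ?_ hlr.le) h1
  exact inv_anti₀ (hpos _) (hanti (by omega))

theorem IsEffectiveDim.lam_le (h : IsEffectiveDim lam r l) (hpos : ∀ j, 0 < lam j) :
    lam l ≤ ((l : ℝ) - r) / invSum lam l := by
  obtain ⟨hr, -, h2⟩ := h
  rw [le_div_iff₀ (invSum_pos hpos (by omega)), mul_comm, ← le_div_iff₀ (hpos l),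
    div_eq_mul_inv]
  exact h2

/-- A nonnegative solution of the linear system is a probability vector. -/
theorem sum_eq_one_of_mulVec_eq (hpos : ∀ j, 0 < lam j) (hr : r < l) {p : RSubset l r → ℝ}
    (hp : (zeroOneMatrix l r).mulVec p = targetVec lam r l) : ∑ I, p I = 1 := by
  have h1 := sum_targetVec (r := r) hpos (show 0 < l by omega)
  rw [← hp] at h1
  simp only [Matrix.mulVec, dotProduct] at h1
  rw [Finset.sum_comm] at h1
  -- Every column has exactly `l - r` ones, so adding all rows of the system gives `(l - r) ∑ p = l
  -- - r`.
  have h2 : ∀ I : RSubset l r, ∑ i, zeroOneMatrix l r i I * p I = ((l : ℝ) - r) * p I := by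
    intro I
    rw [← Finset.sum_mul]
    congr 1
    have h3 : ∀ i, zeroOneMatrix l r i I = 1 - if i ∈ I.1 then 1 else 0 := by
      intro i
      simp only [zeroOneMatrix, Matrix.of_apply]
      split_ifs <;> simp
    simp [h3, I.2]
  simp only [h2, ← Finset.mul_sum] at h1
  have hlr : (0 : ℝ) < l - r := by simpa using hr
  exact mul_left_cancel₀ hlr.ne' (by linarith)

end EffectiveDim

/-! ### Upper bound on the ellipsoid -/

section Ellipsoid

variable {d : ℕ} {P : Measure (Feature d)} (φ : HilbertBasis ℕ ℝ (L2 P)) {lam : ℕ → ℝ}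

/-- A basis indexed by `ℕ` makes `L₂(P)` separable. Hence the product σ-algebra on representations
is the Borel one, and semicontinuity yields measurability. -/
theorem secondCountableTopology_of_hilbertBasis (φ : HilbertBasis ℕ ℝ (L2 P)) :
    SecondCountableTopology (L2 P) := by
  have : TopologicalSpace.SeparableSpace (L2 P) := by
    rw [← TopologicalSpace.isSeparable_univ_iff]
    have h := φ.dense_span
    have h2 : TopologicalSpace.IsSeparable
        (Submodule.span ℝ (Set.range φ) : Set (L2 P)) :=
      (Set.countable_range φ).isSeparable.span
    have h3 := h2.closure
    rwa [← Submodule.topologicalClosure_coe, h] at h3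
  exact UniformSpace.secondCountable_of_separable _

theorem hasSum_repr_sq (f : L2 P) : HasSum (fun j => φ.repr f j ^ 2) (‖f‖ ^ 2) := by
  have h := φ.hasSum_inner_mul_inner f f
  simpa only [real_inner_self_eq_norm_sq, φ.repr_apply_apply, real_inner_comm f,
    ← pow_two] using h

/-- If `λ_l ≤ V`, weighting the squares of the first `l` coordinates by `V / λ_i` instead of `1`
brings the squared norm below `V` on the ellipsoid. -/
theorem norm_sq_sub_sum_mul_repr_sq_le (hpos : ∀ j, 0 < lam j) (hanti : Antitone lam) {f : L2 P}
    (hf : f ∈ ellipsoid φ lam) {l : ℕ} {V : ℝ} (hV : lam l ≤ V) :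
    ‖f‖ ^ 2 - ∑ i ∈ Finset.range l, (1 - V * (lam i)⁻¹) * φ.repr f i ^ 2 ≤ V := by
  obtain ⟨hs, h1⟩ := hf
  have hsum := hasSum_repr_sq φ f
  have hV0 : 0 < V := (hpos l).trans_le hV
  have hfin : HasSum (fun j => if j ∈ Finset.range l then
      (1 - V * (lam j)⁻¹) * φ.repr f j ^ 2 else 0)
      (∑ i ∈ Finset.range l, (1 - V * (lam i)⁻¹) * φ.repr f i ^ 2) := by
    rw [← Finset.sum_congr rfl fun i hi => if_pos hi]
    exact hasSum_sum_of_ne_finset_zero fun j hj => if_neg hj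
  -- Compared with `V f_j² / λ_j` term by term: equality for `j < l`, and `λ_j ≤ λ_l ≤ V`
  -- (zero-based indices) for `j ≥ l`.
  have hle := hasSum_le (fun j => ?_) (hsum.sub hfin) (hs.hasSum.mul_left V)
  · exact hle.trans (by nlinarith)
  · split_ifs with hj
    · exact le_of_eq (by ring)
    · have hj' : lam j ≤ V := (hanti (by simpa using hj)).trans hV
      rw [sub_zero, mul_div_assoc', le_div_iff₀ (hpos j), mul_comm]
      exact mul_le_mul_of_nonneg_right hj' (sq_nonneg _)

theorem norm_sq_le_of_mem_ellipsoid (hpos : ∀ j, 0 < lam j) (hanti : Antitone lam) {f : L2 P}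
    (hf : f ∈ ellipsoid φ lam) : ‖f‖ ^ 2 ≤ lam 0 := by
  simpa using norm_sq_sub_sum_mul_repr_sq_le φ hpos hanti hf (l := 0) le_rfl

theorem zero_mem_ellipsoid : (0 : L2 P) ∈ ellipsoid φ lam := by
  simp [ellipsoid]

theorem orthonormal_subsetRep {l r : ℕ} (I : RSubset l r) : Orthonormal ℝ (subsetRep φ I) :=
  φ.orthonormal.comp _ (Fin.val_injective.comp (I.1.orderEmbOfFin I.2).injective)

theorem sqDistSpan_subsetRep_le {l r : ℕ} (I : RSubset l r) (f : L2 P) :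
    sqDistSpan (subsetRep φ I) f ≤ ‖f‖ ^ 2 - ∑ i ∈ I.1, φ.repr f (i : ℕ) ^ 2 := by
  refine (sqDistSpan_le_of_orthonormal (orthonormal_subsetRep φ I) f).trans_eq ?_
  conv_rhs => rw [← Finset.map_orderEmbOfFin_univ I.1 I.2, Finset.sum_map]
  simp [subsetRep, φ.repr_apply_apply]

/-- The expected squared distance of any point of the ellipsoid to the span of the random subset
of the basis. -/
theorem sum_mul_sqDistSpan_subsetRep_le (hpos : ∀ j, 0 < lam j) (hanti : Antitone lam)
    {r l : ℕ} (hl : IsEffectiveDim lam r l) {p : RSubset l r → ℝ} (hp0 : ∀ I, 0 ≤ p I)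
    (hp : (zeroOneMatrix l r).mulVec p = targetVec lam r l) {f : L2 P}
    (hf : f ∈ ellipsoid φ lam) :
    ∑ I, p I * sqDistSpan (subsetRep φ I) f ≤ ((l : ℝ) - r) / invSum lam l := by
  have hp1 := sum_eq_one_of_mulVec_eq hpos hl.1 hp
  refine le_trans ?_ (norm_sq_sub_sum_mul_repr_sq_le φ hpos hanti hf (hl.lam_le hpos))
  refine (Finset.sum_le_sum fun I _ =>
    mul_le_mul_of_nonneg_left (sqDistSpan_subsetRep_le φ I f) (hp0 I)).trans_eq ?_
  simp only [mul_sub, Finset.sum_sub_distrib, ← Finset.sum_mul, hp1, one_mul]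
  congr 1
  rw [← Fin.sum_univ_eq_sum_range
    (fun i => (1 - ((l : ℝ) - r) / invSum lam l * (lam i)⁻¹) * φ.repr f i ^ 2)]
  -- The coefficient is `p I` if `i ∈ I` and `0` otherwise. Summed over `I` it is the probability `1
  -- - V / λ_i` that `i` is chosen.
  have h1 : ∀ I : RSubset l r, p I * ∑ i ∈ I.1, φ.repr f (i : ℕ) ^ 2 =
      ∑ i, (p I - zeroOneMatrix l r i I * p I) * φ.repr f (i : ℕ) ^ 2 := by
    intro I
    rw [Finset.mul_sum, ← Finset.sum_subset (Finset.subset_univ I.1)]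
    · refine Finset.sum_congr rfl fun i hi => ?_
      simp [zeroOneMatrix, hi]
    · intro i _ hi
      simp [zeroOneMatrix, hi]
  simp only [h1]
  rw [Finset.sum_comm]
  refine Finset.sum_congr rfl fun i _ => ?_
  rw [← Finset.sum_mul, Finset.sum_sub_distrib, hp1]
  have h2 := congrFun hp i
  simp only [Matrix.mulVec, dotProduct] at h2
  rw [h2, targetVec]
  ring

end Ellipsoid

/-! ### Moments of independent random signs -/

section RandomSigns

instance isProbabilityMeasure_rademacher : IsProbabilityMeasure rademacher :=
  ⟨by simp [rademacher, ENNReal.inv_two_add_inv_two]⟩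

theorem ae_sq_eq_one_rademacher : ∀ᵐ t ∂rademacher, t ^ 2 = 1 := by
  rw [rademacher, ae_add_measure_iff]
  exact ⟨Measure.ae_smul_measure (by simp [ae_dirac_eq]) _,
    Measure.ae_smul_measure (by simp [ae_dirac_eq]) _⟩

theorem integral_rademacher : ∫ t, t ∂rademacher = 0 := by
  have h : ∀ a : ℝ, Integrable (fun t : ℝ => t) ((2⁻¹ : ENNReal) • Measure.dirac a) := fun a =>
    (integrable_dirac (by simp)).smul_measure (by simp)
  rw [rademacher, integral_add_measure (h 1) (h (-1))]
  simp [integral_smul_measure]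

variable {Ω' : Type*} [MeasurableSpace Ω'] {Pr' : Measure Ω'} {b : ℕ → Ω' → ℝ}

theorem ae_sq_eq_one (hb : ∀ i, HasLaw (b i) rademacher Pr') :
    ∀ᵐ ω ∂Pr', ∀ i, b i ω ^ 2 = 1 := by
  rw [ae_all_iff]
  intro i
  have h := ae_sq_eq_one_rademacher
  rw [← (hb i).map_eq] at h
  exact ae_of_ae_map (hb i).aemeasurable h

variable [IsProbabilityMeasure Pr']

theorem integrable_sign_mul (hb : ∀ i, HasLaw (b i) rademacher Pr') (i j : ℕ) :
    Integrable (fun ω => b i ω * b j ω) Pr' := by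
  refine Integrable.of_bound
    ((hb i).aemeasurable.mul (hb j).aemeasurable).aestronglyMeasurable 1 ?_
  filter_upwards [ae_sq_eq_one hb] with ω h
  rw [Real.norm_eq_abs, ← sq_le_one_iff_abs_le_one, mul_pow, h i, h j, one_mul]

theorem integral_sign_mul (hb : ∀ i, HasLaw (b i) rademacher Pr') (hind : iIndepFun b Pr')
    (i j : ℕ) : ∫ ω, b i ω * b j ω ∂Pr' = if i = j then 1 else 0 := by
  split_ifs with hij
  · subst hij
    rw [integral_congr_ae (g := fun _ => (1 : ℝ))]
    · simp
    · filter_upwards [ae_sq_eq_one hb] with ω h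
      rw [← pow_two, h i]
  · rw [(hind.indepFun hij).integral_fun_mul_eq_mul_integral
      (hb i).aemeasurable.aestronglyMeasurable (hb j).aemeasurable.aestronglyMeasurable,
      (hb i).integral_eq, integral_rademacher, zero_mul]

/-- The second moment of a linear combination of independent signs. -/
theorem integral_sum_sign_sq (hb : ∀ i, HasLaw (b i) rademacher Pr') (hind : iIndepFun b Pr')
    (s : Finset ℕ) (c : ℕ → ℝ) :
    Integrable (fun ω => (∑ i ∈ s, b i ω * c i) ^ 2) Pr' ∧
      ∫ ω, (∑ i ∈ s, b i ω * c i) ^ 2 ∂Pr' = ∑ i ∈ s, c i ^ 2 := by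
  have h : ∀ ω, (∑ i ∈ s, b i ω * c i) ^ 2 =
      ∑ i ∈ s, ∑ j ∈ s, (b i ω * b j ω) * (c i * c j) := by
    intro ω
    rw [pow_two, Finset.sum_mul_sum]
    exact Finset.sum_congr rfl fun i _ => Finset.sum_congr rfl fun j _ => by ring
  have hint : ∀ i j, Integrable (fun ω => (b i ω * b j ω) * (c i * c j)) Pr' := fun i j =>
    (integrable_sign_mul hb i j).mul_const _
  simp only [h]
  refine ⟨integrable_finsetSum _ fun i _ => integrable_finsetSum _ fun j _ => hint i j, ?_⟩
  rw [integral_finsetSum _ fun i _ => integrable_finsetSum _ fun j _ => hint i j]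
  refine Finset.sum_congr rfl fun i hi => ?_
  rw [integral_finsetSum _ fun j _ => hint i j]
  simp only [integral_mul_const, integral_sign_mul hb hind]
  simp [hi, pow_two]

end RandomSigns

/-! ### Lower bound from the random sign function -/

section SignFunction

open scoped RealInnerProductSpace

variable {d : ℕ} {P : Measure (Feature d)} (φ : HilbertBasis ℕ ℝ (L2 P)) {lam : ℕ → ℝ} {l : ℕ}
  {Ω' : Type*}

theorem inner_signFunction (b : ℕ → Ω' → ℝ) (ω : Ω') (g : L2 P) :
    ⟪g, signFunction φ lam l b ω⟫ =
      ∑ i ∈ Finset.range l, b i ω * (1 / Real.sqrt (invSum lam l) * ⟪g, φ i⟫) := by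
  simp [signFunction, inner_sum, inner_smul_right, mul_assoc]

theorem repr_signFunction (b : ℕ → Ω' → ℝ) (ω : Ω') (j : ℕ) :
    φ.repr (signFunction φ lam l b ω) j =
      if j < l then b j ω * (1 / Real.sqrt (invSum lam l)) else 0 := by
  rw [φ.repr_apply_apply, inner_signFunction]
  simp [orthonormal_iff_ite.1 φ.orthonormal]

variable (lam l) in
/-- The functions whose first `l` squared coordinates are `1 / ∑ λ_i⁻¹`, the others being `0`. -/
def signBox : Set (L2 P) :=
  {f | ∀ j, φ.repr f j ^ 2 = if j < l then (invSum lam l)⁻¹ else 0}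

theorem signFunction_mem_signBox (hpos : ∀ j, 0 < lam j) (hl : 0 < l) {b : ℕ → Ω' → ℝ} {ω : Ω'}
    (hω : ∀ i, b i ω ^ 2 = 1) : signFunction φ lam l b ω ∈ signBox φ lam l := by
  intro j
  rw [repr_signFunction]
  split_ifs
  · rw [mul_pow, hω j, div_pow, Real.sq_sqrt (invSum_pos hpos hl).le]
    simp
  · simp

variable [MeasurableSpace Ω'] {Pr' : Measure Ω'} {b : ℕ → Ω' → ℝ}

theorem aemeasurable_signFunction [SecondCountableTopology (L2 P)]
    (hb : ∀ i, HasLaw (b i) rademacher Pr') : AEMeasurable (signFunction φ lam l b) Pr' := by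
  have h := Finset.aemeasurable_fun_sum (μ := Pr') (Finset.range l)
    (f := fun i ω => (b i ω * (1 / Real.sqrt (invSum lam l))) • φ i)
    fun i _ => ((hb i).aemeasurable.mul_const _).smul_const _
  exact h

/-- This makes `signBox` a measurable event, so almost sure membership passes to the image law
without measurability of the ellipsoid. -/
theorem isClosed_signBox : IsClosed (signBox φ lam l) := by
  rw [signBox, Set.ofPred_forall]
  refine isClosed_iInter fun j => isClosed_eq ?_ continuous_const
  simp only [φ.repr_apply_apply]
  fun_prop

theorem signBox_subset_ellipsoid (hpos : ∀ j, 0 < lam j) (hl : 0 < l) :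
    signBox φ lam l ⊆ ellipsoid φ lam := by
  intro f hf
  have hS := (invSum_pos hpos hl).ne'
  have h0 : ∀ j ∉ Finset.range l, φ.repr f j ^ 2 / lam j = 0 := by
    intro j hj
    rw [hf j, if_neg (by simpa using hj), zero_div]
  refine ⟨summable_of_ne_finset_zero h0, le_of_eq ?_⟩
  rw [tsum_eq_sum h0]
  calc ∑ j ∈ Finset.range l, φ.repr f j ^ 2 / lam j
      = ∑ j ∈ Finset.range l, (invSum lam l)⁻¹ * (lam j)⁻¹ := by
        refine Finset.sum_congr rfl fun j hj => ?_
        rw [hf j, if_pos (by simpa using hj), div_eq_mul_inv]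
    _ = 1 := by
        rw [← Finset.mul_sum]
        exact inv_mul_cancel₀ hS

theorem isPrior_map_signFunction [IsProbabilityMeasure Pr'] [SecondCountableTopology (L2 P)]
    (hpos : ∀ j, 0 < lam j) (hl : 0 < l) (hb : ∀ i, HasLaw (b i) rademacher Pr') :
    IsPrior (ellipsoid φ lam) (Pr'.map (signFunction φ lam l b)) := by
  have hm := aemeasurable_signFunction φ (lam := lam) (l := l) hb
  refine ⟨Measure.isProbabilityMeasure_map hm, ?_⟩
  have h : ∀ᵐ f ∂Pr'.map (signFunction φ lam l b), f ∈ signBox φ lam l := by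
    rw [ae_map_iff (p := fun f => f ∈ signBox φ lam l) hm (isClosed_signBox φ).measurableSet]
    filter_upwards [ae_sq_eq_one hb] with ω hω
    exact signFunction_mem_signBox φ hpos hl hω
  exact h.mono fun f hf => signBox_subset_ellipsoid φ hpos hl hf

/-- No `r`-dimensional space approximates the random sign function with expected squared error
below `(l - r) / ∑ λ_i⁻¹`. -/
theorem le_integral_sqDistSpan_signFunction [IsProbabilityMeasure Pr']
    [SecondCountableTopology (L2 P)] (hpos : ∀ j, 0 < lam j) (hl : 0 < l)
    (hb : ∀ i, HasLaw (b i) rademacher Pr') (hind : iIndepFun b Pr') {r : ℕ} (R : Rep P r) :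
    ((l : ℝ) - r) / invSum lam l ≤ ∫ f, sqDistSpan R f ∂Pr'.map (signFunction φ lam l b) := by
  have hm := aemeasurable_signFunction φ (lam := lam) (l := l) hb
  have hS := invSum_pos (l := l) hpos hl
  have hmeas : Measurable fun f : L2 P => sqDistSpan R f :=
    measurable_sqDistSpan_right R
  rw [integral_map hm hmeas.aestronglyMeasurable]
  obtain ⟨m, e, hmr, he, hdist⟩ := exists_orthonormal_le_sqDistSpan R
  have hnorm : ∀ᵐ ω ∂Pr', ‖signFunction φ lam l b ω‖ ^ 2 = l / invSum lam l := by
    filter_upwards [ae_sq_eq_one hb] with ω hω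
    have h1 := signFunction_mem_signBox φ hpos hl hω
    have h2 := hasSum_repr_sq φ (signFunction φ lam l b ω)
    rw [← h2.tsum_eq, tsum_congr h1, tsum_eq_sum (s := Finset.range l)]
    · rw [Finset.sum_congr rfl fun j hj => if_pos (Finset.mem_range.1 hj)]
      simp [div_eq_mul_inv]
    · intro j hj
      exact if_neg (by simpa using hj)
  set c : Fin m → ℕ → ℝ := fun k i => 1 / Real.sqrt (invSum lam l) * ⟪e k, φ i⟫ with hc
  have hmom := fun k => integral_sum_sign_sq hb hind (Finset.range l) (c k)
  -- Bessel for the unit vector `e k` against the `φ i`: each direction captures at most `1 / S`,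
  -- and there are `m ≤ r` directions.
  have hbessel : ∑ k, ∑ i ∈ Finset.range l, c k i ^ 2 ≤ r / invSum lam l := by
    have h1 : ∀ k, ∑ i ∈ Finset.range l, c k i ^ 2 ≤ (invSum lam l)⁻¹ := by
      intro k
      have h2 := φ.orthonormal.sum_inner_products_le (e k) (s := Finset.range l)
      rw [he.1 k] at h2
      simp only [hc, mul_pow, ← Finset.mul_sum, div_pow, Real.sq_sqrt hS.le]
      simp only [Real.norm_eq_abs, sq_abs, one_pow, real_inner_comm (e k)] at h2
      simpa [real_inner_comm (e k)] using mul_le_mul_of_nonneg_left h2 (inv_pos.2 hS).le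
    refine (Finset.sum_le_sum fun k _ => h1 k).trans ?_
    rw [Finset.sum_const, Finset.card_univ, Fintype.card_fin, nsmul_eq_mul, div_eq_mul_inv]
    exact mul_le_mul_of_nonneg_right (by exact_mod_cast hmr) (inv_pos.2 hS).le
  have hI : Integrable (fun ω => (l : ℝ) / invSum lam l -
      ∑ k, (∑ i ∈ Finset.range l, b i ω * c k i) ^ 2) Pr' :=
    (integrable_const _).sub (integrable_finsetSum _ fun k _ => (hmom k).1)
  calc ((l : ℝ) - r) / invSum lam l
      ≤ ∫ ω, (l : ℝ) / invSum lam l -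
          ∑ k, (∑ i ∈ Finset.range l, b i ω * c k i) ^ 2 ∂Pr' := by
        rw [integral_sub (integrable_const _) (integrable_finsetSum _ fun k _ => (hmom k).1),
          integral_finsetSum _ fun k _ => (hmom k).1]
        simp only [(hmom _).2, integral_const, probReal_univ, one_smul, sub_div]
        linarith
    _ ≤ ∫ ω, sqDistSpan R (signFunction φ lam l b ω) ∂Pr' := by
        refine integral_mono_ae hI ?_ ?_
        · refine Integrable.of_bound (hmeas.comp_aemeasurable hm).aestronglyMeasurable
            (l / invSum lam l) ?_
          filter_upwards [hnorm] with ω hω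
          rw [Real.norm_of_nonneg (sqDistSpan_nonneg _ _), ← hω]
          exact sqDistSpan_le_norm_sq _ _
        · filter_upwards [hnorm] with ω hω
          rw [← hω]
          refine le_trans (le_of_eq ?_) (hdist _)
          simp only [inner_signFunction, hc]

end SignFunction

/-! ### Weak duality and the saddle point -/

section Duality

variable {d : ℕ} {P : Measure (Feature d)} {Ω : Type*} [MeasurableSpace Ω]
  {Pr : Measure Ω} {x : Ω → Feature d} {n : Ω → ℝ} {r : ℕ}
  (φ : HilbertBasis ℕ ℝ (L2 P)) {lam : ℕ → ℝ}

theorem sqDistSpan_le_of_mem_ellipsoid (hpos : ∀ j, 0 < lam j) (hanti : Antitone lam)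
    (R : Rep P r) {f : L2 P} (hf : f ∈ ellipsoid φ lam) : sqDistSpan R f ≤ lam 0 :=
  (sqDistSpan_le_norm_sq R f).trans (norm_sq_le_of_mem_ellipsoid φ hpos hanti hf)

theorem integrable_sqDistSpan_left [SecondCountableTopology (L2 P)] (μ : Measure (Rep P r))
    [IsFiniteMeasure μ] (f : L2 P) : Integrable (fun R : Rep P r => sqDistSpan R f) μ := by
  refine Integrable.of_bound (measurable_sqDistSpan_left f).aestronglyMeasurable (‖f‖ ^ 2)
    (Eventually.of_forall fun R => ?_)
  rw [Real.norm_of_nonneg (sqDistSpan_nonneg _ _)]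
  exact sqDistSpan_le_norm_sq R f

theorem integrable_sqDistSpan_prod [SecondCountableTopology (L2 P)] (hpos : ∀ j, 0 < lam j)
    (hanti : Antitone lam) (μ : Measure (Rep P r)) [IsFiniteMeasure μ] (ν : Measure (L2 P))
    (hν : IsPrior (ellipsoid φ lam) ν) :
    Integrable (fun z : Rep P r × L2 P => sqDistSpan z.1 z.2) (μ.prod ν) := by
  have := hν.1
  refine Integrable.of_bound measurable_sqDistSpan.aestronglyMeasurable (lam 0) ?_
  filter_upwards [Measure.quasiMeasurePreserving_snd.ae hν.2] with z hz
  rw [Real.norm_of_nonneg (sqDistSpan_nonneg _ _)]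
  exact sqDistSpan_le_of_mem_ellipsoid φ hpos hanti _ hz

/-- Weak duality: the Bayes regret of a prior is at most the worst regret of a random
representation. -/
theorem bayesRegret_le_worstRegret [SecondCountableTopology (L2 P)] (hpos : ∀ j, 0 < lam j)
    (hanti : Antitone lam) (hreg : ∀ (R : Rep P r) (f : L2 P), regret Pr x n R f = sqDistSpan R f)
    (μ : Measure (Rep P r)) [IsProbabilityMeasure μ] (ν : Measure (L2 P))
    (hν : IsPrior (ellipsoid φ lam) ν) :
    bayesRegret r Pr x n ν ≤ worstRegret Pr x n (ellipsoid φ lam) μ := by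
  have := hν.1
  have hI := integrable_sqDistSpan_prod φ hpos hanti μ ν hν
  simp only [bayesRegret, worstRegret, hreg]
  -- Real infima and suprema of unbounded families have junk values, so both families must be shown
  -- bounded.
  have hbdd : BddBelow (Set.range fun R : Rep P r => ∫ f, sqDistSpan R f ∂ν) := by
    refine ⟨0, ?_⟩
    rintro _ ⟨R, rfl⟩
    exact integral_nonneg fun f => sqDistSpan_nonneg R f
  have habove : BddAbove (Set.range fun f : ellipsoid φ lam =>
      ∫ R : Rep P r, sqDistSpan R (f : L2 P) ∂μ) := by
    refine ⟨lam 0, ?_⟩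
    rintro _ ⟨f, rfl⟩
    have h := integral_mono (integrable_sqDistSpan_left μ (f : L2 P)) (integrable_const (lam 0))
      fun R => sqDistSpan_le_of_mem_ellipsoid φ hpos hanti R f.2
    simpa using h
  calc ⨅ R : Rep P r, ∫ f, sqDistSpan R f ∂ν
      = ∫ _ : Rep P r, (⨅ R : Rep P r, ∫ f, sqDistSpan R f ∂ν) ∂μ := by simp
    _ ≤ ∫ R, ∫ f, sqDistSpan R f ∂ν ∂μ :=
        integral_mono (integrable_const _) hI.integral_prod_left fun R => ciInf_le hbdd R
    _ = ∫ f, ∫ R : Rep P r, sqDistSpan R f ∂μ ∂ν := integral_integral_swap hI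
    _ ≤ ∫ _ : L2 P, (⨆ f : ellipsoid φ lam, ∫ R : Rep P r, sqDistSpan R (f : L2 P) ∂μ) ∂ν := by
        refine integral_mono_ae hI.integral_prod_right (integrable_const _) ?_
        filter_upwards [hν.2] with f hf
        exact le_ciSup habove ⟨f, hf⟩
    _ = _ := by simp

theorem isProbabilityMeasure_subsetLaw {l : ℕ} {p : RSubset l r → ℝ} (hp0 : ∀ I, 0 ≤ p I)
    (hp1 : ∑ I, p I = 1) : IsProbabilityMeasure (subsetLaw φ p) := by
  refine ⟨?_⟩
  simp only [subsetLaw, Measure.coe_finsetSum, Finset.sum_apply, Measure.smul_apply,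
    measure_univ, smul_eq_mul, mul_one]
  rw [← ENNReal.ofReal_sum_of_nonneg fun I _ => hp0 I, hp1, ENNReal.ofReal_one]

theorem integral_subsetLaw [SecondCountableTopology (L2 P)] {l : ℕ} {p : RSubset l r → ℝ}
    (hp0 : ∀ I, 0 ≤ p I) (f : L2 P) :
    ∫ R, sqDistSpan R f ∂subsetLaw φ p = ∑ I, p I * sqDistSpan (subsetRep φ I) f := by
  rw [subsetLaw, integral_finsetSum_measure fun I _ =>
    (integrable_sqDistSpan_left _ f).smul_measure ENNReal.ofReal_ne_top]
  simp [integral_smul_measure, ENNReal.toReal_ofReal (hp0 _)]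

theorem worstRegret_subsetLaw_le [SecondCountableTopology (L2 P)] (hpos : ∀ j, 0 < lam j)
    (hanti : Antitone lam) (hreg : ∀ (R : Rep P r) (f : L2 P), regret Pr x n R f = sqDistSpan R f)
    {l : ℕ} (hl : IsEffectiveDim lam r l) {p : RSubset l r → ℝ} (hp0 : ∀ I, 0 ≤ p I)
    (hp : (zeroOneMatrix l r).mulVec p = targetVec lam r l) :
    worstRegret Pr x n (ellipsoid φ lam) (subsetLaw φ p) ≤ ((l : ℝ) - r) / invSum lam l := by
  have : Nonempty (ellipsoid φ lam) := ⟨⟨0, zero_mem_ellipsoid φ⟩⟩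
  refine ciSup_le fun f => ?_
  simp only [hreg, integral_subsetLaw φ hp0]
  exact sum_mul_sqDistSpan_subsetRep_le φ hpos hanti hl hp0 hp f.2

theorem le_bayesRegret_map_signFunction [SecondCountableTopology (L2 P)] (hpos : ∀ j, 0 < lam j)
    (hreg : ∀ (R : Rep P r) (f : L2 P), regret Pr x n R f = sqDistSpan R f) {l : ℕ} (hl : 0 < l)
    {Ω' : Type*} [MeasurableSpace Ω'] {Pr' : Measure Ω'} [IsProbabilityMeasure Pr']
    {b : ℕ → Ω' → ℝ} (hb : ∀ i, HasLaw (b i) rademacher Pr') (hind : iIndepFun b Pr') :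
    ((l : ℝ) - r) / invSum lam l ≤
      bayesRegret r Pr x n (Pr'.map (signFunction φ lam l b)) := by
  refine le_ciInf fun R => ?_
  simp only [hreg]
  exact le_integral_sqDistSpan_signFunction φ hpos hl hb hind R

/-- The value of a game from a saddle point. -/
theorem value_eq_of_saddle {F : Set (L2 P)} {V : ℝ}
    (hdual : ∀ (μ : Measure (Rep P r)) (ν : Measure (L2 P)), IsProbabilityMeasure μ →
      IsPrior F ν → bayesRegret r Pr x n ν ≤ worstRegret Pr x n F μ)
    {μ : Measure (Rep P r)} (hμ : IsProbabilityMeasure μ) (hμV : worstRegret Pr x n F μ ≤ V)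
    {ν : Measure (L2 P)} (hν : IsPrior F ν) (hνV : V ≤ bayesRegret r Pr x n ν) :
    mixedMinimaxRegret r Pr x n F = V ∧ mixedMaximinRegret r Pr x n F = V ∧
      IsMinimaxLaw Pr x n F μ ∧ IsLeastFavorable r Pr x n F ν := by
  have hle : V ≤ worstRegret Pr x n F μ := hνV.trans (hdual μ ν hμ hν)
  have : Nonempty {μ : Measure (Rep P r) // IsProbabilityMeasure μ} := ⟨⟨μ, hμ⟩⟩
  have : Nonempty {ν : Measure (L2 P) // IsPrior F ν} := ⟨⟨ν, hν⟩⟩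
  have hmin : mixedMinimaxRegret r Pr x n F = V := by
    have hlow : ∀ μ' : {μ : Measure (Rep P r) // IsProbabilityMeasure μ},
        V ≤ worstRegret Pr x n F μ'.1 := fun μ' => hνV.trans (hdual μ'.1 ν μ'.2 hν)
    refine le_antisymm ((ciInf_le ⟨V, ?_⟩ ⟨μ, hμ⟩).trans hμV) (le_ciInf hlow)
    rintro _ ⟨μ', rfl⟩
    exact hlow μ'
  have hmax : mixedMaximinRegret r Pr x n F = V := by
    have hup : ∀ ν' : {ν : Measure (L2 P) // IsPrior F ν}, bayesRegret r Pr x n ν'.1 ≤ V :=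
      fun ν' => (hdual μ ν'.1 hμ ν'.2).trans hμV
    refine le_antisymm (ciSup_le hup) (hνV.trans (le_ciSup (f := fun
      ν' : {ν : Measure (L2 P) // IsPrior F ν} => bayesRegret r Pr x n ν'.1) ⟨V, ?_⟩ ⟨ν, hν⟩))
    rintro _ ⟨ν', rfl⟩
    exact hup ν'
  refine ⟨hmin, hmax, ⟨hμ, hmin ▸ le_antisymm hμV hle⟩, hν, ?_⟩
  rw [hmax]
  exact le_antisymm ((hdual μ ν hμ hν).trans hμV) hνV

end Duality

end HilbertMSE

end

/-! ### The main theorem -/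

open HilbertMSE in
theorem mainTheorem5 {d : ℕ}
    -- the features, with law `P` supported on a compact set, and the independent noise
    (P : Measure (Feature d)) [IsProbabilityMeasure P]
    (K : Set (Feature d)) (hK : IsCompact K) (hPK : P Kᶜ = 0)
    {Ω : Type*} [MeasurableSpace Ω] (Pr : Measure Ω) [IsProbabilityMeasure Pr]
    (x : Ω → Feature d) (n : Ω → ℝ) (hx : HasLaw x P Pr)
    (hn : MemLp n 2 Pr) (hn0 : ∫ ω, n ω ∂Pr = 0) (hxn : IndepFun x n Pr)
    -- the orthonormal basis and the ellipsoid; `lam j` is `λ_{j+1}` and `φ j` is `φ_{j+1}`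
    (φ : HilbertBasis ℕ ℝ (L2 P))
    (lam : ℕ → ℝ) (hpos : ∀ j, 0 < lam j) (hanti : Antitone lam)
    (hlim : Tendsto lam atTop (𝓝 0)) (r : ℕ) :
    -- all expected regrets are expectations of bounded measurable functions
    ((∀ f : L2 P, Measurable fun R : Rep P r => regret Pr x n R f) ∧
      (∀ R : Rep P r, Measurable fun f : L2 P => regret Pr x n R f) ∧
      (∀ f ∈ ellipsoid φ lam, ∀ R : Rep P r,
        0 ≤ regret Pr x n R f ∧ regret Pr x n R f ≤ lam 0)) ∧
    (∃ l, IsEffectiveDim lam r l) ∧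
    ∀ l, IsEffectiveDim lam r l →
      -- the value of the game
      mixedMinimaxRegret r Pr x n (ellipsoid φ lam) = ((l : ℝ) - r) / invSum lam l ∧
      mixedMaximinRegret r Pr x n (ellipsoid φ lam) = ((l : ℝ) - r) / invSum lam l ∧
      -- the least favorable prior
      (∀ (Ω' : Type*) [MeasurableSpace Ω'] (Pr' : Measure Ω') [IsProbabilityMeasure Pr']
        (b : ℕ → Ω' → ℝ), (∀ i, HasLaw (b i) rademacher Pr') → iIndepFun b Pr' →
        IsLeastFavorable r Pr x n (ellipsoid φ lam) (Pr'.map (signFunction φ lam l b))) ∧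
      -- the minimax representation
      (∃ p : RSubset l r → ℝ, (∀ I, p I ∈ Set.Icc (0 : ℝ) 1) ∧
        (zeroOneMatrix l r).mulVec p = targetVec lam r l ∧
        {I | p I ≠ 0}.ncard ≤ l + 1) ∧
      (∀ p : RSubset l r → ℝ, (∀ I, p I ∈ Set.Icc (0 : ℝ) 1) →
        (zeroOneMatrix l r).mulVec p = targetVec lam r l →
        IsMinimaxLaw Pr x n (ellipsoid φ lam) (subsetLaw φ p)) := by
  have hreg : ∀ (R : Rep P r) (f : L2 P), regret Pr x n R f = sqDistSpan R f :=
    regret_eq hx hn hn0 hxn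
  have : SecondCountableTopology (L2 P) := secondCountableTopology_of_hilbertBasis φ
  refine ⟨⟨fun f => ?_, fun R => ?_, fun f hf R => ?_⟩,
    exists_isEffectiveDim hpos hanti hlim r, fun l hl => ?_⟩
  · simp only [hreg]
    exact measurable_sqDistSpan_left f
  · simp only [hreg]
    exact measurable_sqDistSpan_right R
  · rw [hreg]
    exact ⟨sqDistSpan_nonneg R f, sqDistSpan_le_of_mem_ellipsoid φ hpos hanti R hf⟩
  have hl0 : 0 < l := (Nat.zero_le r).trans_lt hl.1
  have hdual : ∀ (μ : Measure (Rep P r)) (ν : Measure (L2 P)), IsProbabilityMeasure μ →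
      IsPrior (ellipsoid φ lam) ν →
      bayesRegret r Pr x n ν ≤ worstRegret Pr x n (ellipsoid φ lam) μ := fun μ ν _ hν =>
    bayesRegret_le_worstRegret φ hpos hanti hreg μ ν hν
  obtain ⟨p, hp01, hp, hcard⟩ := exists_zeroOneMatrix_mulVec_eq hl.1.le
    (hl.targetVec_mem_Icc hpos hanti) (sum_targetVec hpos hl0)
  have hprob : ∀ q : RSubset l r → ℝ, (∀ I, q I ∈ Set.Icc (0 : ℝ) 1) →
      (zeroOneMatrix l r).mulVec q = targetVec lam r l →
      IsProbabilityMeasure (subsetLaw φ q) := fun q hq01 hq =>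
    isProbabilityMeasure_subsetLaw φ (fun I => (hq01 I).1) (sum_eq_one_of_mulVec_eq hpos hl.1 hq)
  have hworst : ∀ q : RSubset l r → ℝ, (∀ I, q I ∈ Set.Icc (0 : ℝ) 1) →
      (zeroOneMatrix l r).mulVec q = targetVec lam r l →
      worstRegret Pr x n (ellipsoid φ lam) (subsetLaw φ q) ≤ ((l : ℝ) - r) / invSum lam l :=
    fun q hq01 hq => worstRegret_subsetLaw_le φ hpos hanti hreg hl (fun I => (hq01 I).1) hq
  -- The value and the minimax laws involve no given signs, so a reference sequence is constructed.
  -- Any solution `q` is then paired with its prior, and any other sign sequence with the fixed `p`.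
  obtain ⟨Ω₀, _, Pr₀, b₀, -, hb₀, hind₀, _⟩ := exists_iid ℕ rademacher
  have hν₀ := isPrior_map_signFunction φ hpos hl0 hb₀
  have hbayes₀ := le_bayesRegret_map_signFunction (r := r) φ hpos hreg hl0 hb₀ hind₀
  obtain ⟨hmin, hmax, -, -⟩ :=
    value_eq_of_saddle hdual (hprob p hp01 hp) (hworst p hp01 hp) hν₀ hbayes₀
  refine ⟨hmin, hmax, fun Ω' _ Pr' _ b hb hind => ?_, ⟨p, hp01, hp, hcard⟩,
    fun q hq01 hq => ?_⟩
  · exact (value_eq_of_saddle hdual (hprob p hp01 hp) (hworst p hp01 hp)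
      (isPrior_map_signFunction φ hpos hl0 hb)
      (le_bayesRegret_map_signFunction φ hpos hreg hl0 hb hind)).2.2.2
  · exact (value_eq_of_saddle hdual (hprob q hq01 hq) (hworst q hq01 hq) hν₀ hbayes₀).2.2.1
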